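/- **Theorem 6 (Upper Bound).** Let $\mathcal X,\mathcal Y,\mathcal Z$ be finite alphabets, let $\{p(y_i\mid x^i,y^{i-1})\}_{i\ge1}$ be a channel and $\{p(z_i\mid y^i,z^{i-1})\}_{i\ge1}$ a (noisy) feedback link. A code with $M\ge 1$ messages over the horizon $n$ consists of code-functions $f^n[w]=(f_i[w]:\mathcal Z^{i-1}\to\mathcal X)_{i=1}^n$, $w=1,\dots,M$, and a decoder $g:\mathcal Y^n\to\{1,\dots,M\}$; the message $w$ is sent through $x_i=f_i[w](z^{i-1})$, and the error probability of the code is $\frac1M\sum_{w=1}^M \Pr\{g(Y^n)\ne w\mid w\}$. A rate $R\ge0$ is $\epsilon$-achievable if for every $\delta>0$ and all sufficiently large $n$ there is a code over the horizon $n$ with error probability at most $\epsilon$ and $\frac1n\log_2 M\ge R-\delta$. The noisy-feedback capacity $C_{FB}^{noise}$ is the supremum of the rates that are $\epsilon$-achievable for all $0<\epsilon<1$. Then $$C_{FB}^{noise}\;\le\;\sup_{X}\ \liminf_{n\to\infty}\ \frac1n\, I(X^n\to Y^n\,\|\,Z^n).$$ Here the supremum is over all input processes $X$, that is, over all sequences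 which assign to every horizon $n$ a channel input distribution $\{p^{(n)}(x_i\mid x^{i-1},z^{i-1})\}_{i=1}^n$ (no consistency between different horizons being required), $(X^n,Y^n,Z^n)$ has the joint law $p(x^n,y^n,z^n)=\prod_{i=1}^n p^{(n)}(x_i\mid x^{i-1},z^{i-1})\,p(y_i\mid x^i,y^{i-1})\,p(z_i\mid y^i,z^{i-1})$, and $$I(X^n\to Y^n\,\|\,Z^n)=\mathbb E\,\log_2\frac{\prod_{i=1}^n p(Y_i\mid X^i,Y^{i-1},Z^{i-1})}{\prod_{i=1}^n p(Y_i\mid Y^{i-1},Z^{i-1})}$$ is the causal conditional directed information. -/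

import Mathlib

open Filter

namespace NoisyFeedback

/-- A finite-alphabet channel with a noisy feedback link. Times are indexed from `0`, so that the
time called `i + 1` in the usual notation is `i` here: `forward i x y` is the law
`p(y_{i+1} | x^{i+1} = x, y^i = y)` of the channel output and `feedback i y z` is the law
`p(z_{i+1} | y^{i+1} = y, z^i = z)` of the output of the feedback link. -/
structure Channel (𝒳 𝒴 𝒵 : Type*) where
  forward : (i : ℕ) → (Fin (i + 1) → 𝒳) → (Fin i → 𝒴) → PMF 𝒴
  feedback : (i : ℕ) → (Fin (i + 1) → 𝒴) → (Fin i → 𝒵) → PMF 𝒵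

/-- A channel input distribution `{p(x_i | x^{i-1}, z^{i-1})}_{i=1}^n` over the horizon `n`. -/
abbrev InputDist (𝒳 𝒵 : Type*) (n : ℕ) : Type _ :=
  (i : Fin n) → (Fin i → 𝒳) → (Fin i → 𝒵) → PMF 𝒳

/-- An input process: a channel input distribution for every horizon `n`. As for general input
processes in information-spectrum theory, no consistency between horizons is imposed. -/
abbrev InputProcess (𝒳 𝒵 : Type*) : Type _ := (n : ℕ) → InputDist 𝒳 𝒵 n

section Information

variable {𝒳 𝒴 𝒵 : Type*} [Fintype 𝒳] [Fintype 𝒴] [Fintype 𝒵]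
  [DecidableEq 𝒳] [DecidableEq 𝒴] [DecidableEq 𝒵] {n : ℕ}

/-- The probability `p(x^a, y^b, z^c)` of the prefixes of lengths `a, b, c` of the sequences
`x, y, z`, when `P` is the joint probability mass function of `(X^n, Y^n, Z^n)`. -/
noncomputable def prefixProb (P : (Fin n → 𝒳) → (Fin n → 𝒴) → (Fin n → 𝒵) → ℝ)
    (a b c : ℕ) (ha : a ≤ n) (hb : b ≤ n) (hc : c ≤ n)
    (x : Fin n → 𝒳) (y : Fin n → 𝒴) (z : Fin n → 𝒵) : ℝ :=
  ∑ x' : Fin n → 𝒳, ∑ y' : Fin n → 𝒴, ∑ z' : Fin n → 𝒵,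
    if Fin.take a ha x' = Fin.take a ha x ∧ Fin.take b hb y' = Fin.take b hb y ∧
        Fin.take c hc z' = Fin.take c hc z
    then P x' y' z' else 0

/-- The causal conditional probability `∏_i p(y_i | x^i, y^{i-1}, z^{i-1})`. -/
noncomputable def causalProbXZ (P : (Fin n → 𝒳) → (Fin n → 𝒴) → (Fin n → 𝒵) → ℝ)
    (x : Fin n → 𝒳) (y : Fin n → 𝒴) (z : Fin n → 𝒵) : ℝ :=
  ∏ i : Fin n,
    prefixProb P (i + 1) (i + 1) i i.isLt i.isLt i.isLt.le x y z /
      prefixProb P (i + 1) i i i.isLt i.isLt.le i.isLt.le x y z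

/-- The causal conditional probability `∏_i p(y_i | y^{i-1}, z^{i-1})`
(the prefix of `x` of length `0` is empty, so `x` plays no role). -/
noncomputable def causalProbZ (P : (Fin n → 𝒳) → (Fin n → 𝒴) → (Fin n → 𝒵) → ℝ)
    (x : Fin n → 𝒳) (y : Fin n → 𝒴) (z : Fin n → 𝒵) : ℝ :=
  ∏ i : Fin n,
    prefixProb P 0 (i + 1) i n.zero_le i.isLt i.isLt.le x y z /
      prefixProb P 0 i i n.zero_le i.isLt.le i.isLt.le x y z

/-- The causal conditional directed information `I(X^n → Y^n || Z^n)` in bits, when `P` is the joint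
probability mass function of `(X^n, Y^n, Z^n)`. Wherever `P` is positive, so are all the
probabilities that occur in the logarithm. -/
noncomputable def causalDirectedInfo
    (P : (Fin n → 𝒳) → (Fin n → 𝒴) → (Fin n → 𝒵) → ℝ) : ℝ :=
  ∑ x : Fin n → 𝒳, ∑ y : Fin n → 𝒴, ∑ z : Fin n → 𝒵,
    P x y z * Real.logb 2 (causalProbXZ P x y z / causalProbZ P x y z)

end Information

/-- A channel code over the horizon `n` with `M` messages: a code-function
`f^n[w] = (f_i[w] : 𝒵^{i-1} → 𝒳)_{i ≤ n}` for every message `w`, and a decoder. -/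
structure Code (𝒳 𝒴 𝒵 : Type*) (n M : ℕ) where
  encode : Fin M → (i : Fin n) → (Fin i → 𝒵) → 𝒳
  decode : (Fin n → 𝒴) → Fin M

/-- The channel inputs that a code produces for the message `w` when the feedback link puts
out `z`. -/
def Code.input {𝒳 𝒴 𝒵 : Type*} {n M : ℕ} (c : Code 𝒳 𝒴 𝒵 n M) (w : Fin M) (z : Fin n → 𝒵) :
    Fin n → 𝒳 :=
  fun i => c.encode w i (Fin.take i i.isLt.le z)

namespace Channel

variable {𝒳 𝒴 𝒵 : Type*}

/-- The product `∏_i p(y_i | x^i, y^{i-1}) p(z_i | y^i, z^{i-1})`. -/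
noncomputable def transition (C : Channel 𝒳 𝒴 𝒵) {n : ℕ}
    (x : Fin n → 𝒳) (y : Fin n → 𝒴) (z : Fin n → 𝒵) : ℝ :=
  ∏ i : Fin n,
    (C.forward i (Fin.take (i + 1) i.isLt x) (Fin.take i i.isLt.le y) (y i)).toReal *
      (C.feedback i (Fin.take (i + 1) i.isLt y) (Fin.take i i.isLt.le z) (z i)).toReal

/-- The joint probability mass function of `(X^n, Y^n, Z^n)` under a channel input distribution. -/
noncomputable def jointProb (C : Channel 𝒳 𝒴 𝒵) {n : ℕ} (q : InputDist 𝒳 𝒵 n)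
    (x : Fin n → 𝒳) (y : Fin n → 𝒴) (z : Fin n → 𝒵) : ℝ :=
  (∏ i : Fin n, (q i (Fin.take i i.isLt.le x) (Fin.take i i.isLt.le z) (x i)).toReal) *
    C.transition x y z

variable [Fintype 𝒴] [Fintype 𝒵]

/-- The probability that the message `w` is decoded wrongly, given that it is sent. -/
noncomputable def errorProb (C : Channel 𝒳 𝒴 𝒵) {n M : ℕ} (c : Code 𝒳 𝒴 𝒵 n M)
    (w : Fin M) : ℝ :=
  ∑ y : Fin n → 𝒴, ∑ z : Fin n → 𝒵,
    if c.decode y ≠ w then C.transition (c.input w z) y z else 0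

/-- The error probability of a code, averaged over the messages. -/
noncomputable def avgErrorProb (C : Channel 𝒳 𝒴 𝒵) {n M : ℕ} (c : Code 𝒳 𝒴 𝒵 n M) : ℝ :=
  (1 / (M : ℝ)) * ∑ w : Fin M, C.errorProb c w

/-- `R ≥ 0` is an `ε`-achievable rate: for every `δ > 0` there is, for all sufficiently large `n`,
a code over the horizon `n` of rate at least `R - δ` whose error probability is at most `ε`. -/
def IsEpsAchievable (C : Channel 𝒳 𝒴 𝒵) (ε R : ℝ) : Prop :=
  0 ≤ R ∧ ∀ δ : ℝ, 0 < δ → ∀ᶠ n : ℕ in atTop, ∃ M : ℕ, 0 < M ∧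
    ∃ c : Code 𝒳 𝒴 𝒵 n M, C.avgErrorProb c ≤ ε ∧ R - δ ≤ Real.logb 2 M / n

/-- The capacity: the supremum of the rates that are `ε`-achievable for all `0 < ε < 1`. -/
noncomputable def capacity (C : Channel 𝒳 𝒴 𝒵) : EReal :=
  sSup ((fun R : ℝ => (R : EReal)) ''
    {R : ℝ | ∀ ε : ℝ, 0 < ε → ε < 1 → C.IsEpsAchievable ε R})

end Channel

end NoisyFeedback

/-! The argument is the converse via Fano's inequality, with all of `(Y^n, Z^n)` kept as the
observation. A code with uniform message `W` induces an input distribution: given the past inputs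
and feedback, draw uniformly among the messages consistent with them and send the next letter of
that message. The resulting joint law is exactly that of the code (`jointProb_inputDist`), because
the transition depends on the message only through the inputs.

For any input distribution the feedback factors cancel, so the directed information is the
expectation of `log (transition / output law)` (`causalDirectedInfo_jointProb`). For a code this is
the mutual information of `W` and `(Y^n, Z^n)`, and a Gibbs-type inequality bounds it below by `(1 -
error) log M - 1` (`le_causalDirectedInfo`). Dividing by `n` and taking the error level small shows
that every `r` below an achievable rate is eventually reached. Since horizons need not be
consistent, the induced distributions form one input process. -/

namespace NoisyFeedback

/-! ### Marginals of prefixes. -/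

section PrefixProb

variable {𝒳 𝒴 𝒵 : Type*} [Fintype 𝒳] [Fintype 𝒴] [Fintype 𝒵]
  [DecidableEq 𝒳] [DecidableEq 𝒴] [DecidableEq 𝒵] {n : ℕ}

theorem take_eq_take_iff {α : Type*} {a : ℕ} (ha : a ≤ n) (x x' : Fin n → α) :
    Fin.take a ha x' = Fin.take a ha x ↔ ∀ j : Fin n, (j : ℕ) < a → x' j = x j := by
  constructor
  · intro h j hj
    exact congrFun h ⟨j, hj⟩
  · intro h
    funext j
    exact h (Fin.castLE ha j) j.isLt

theorem take_update_of_le {α : Type*} {a : ℕ} (ha : a ≤ n) (x : Fin n → α) (i : Fin n)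
    (hi : a ≤ i) (s : α) : Fin.take a ha (Function.update x i s) = Fin.take a ha x := by
  rw [take_eq_take_iff]
  intro j hj
  rw [Function.update_of_ne]
  rintro rfl
  omega

theorem take_succ_eq_take_update_iff {α : Type*} {a : ℕ} (ha : a < n) (x x' : Fin n → α) (s : α) :
    Fin.take (a + 1) ha x' = Fin.take (a + 1) ha (Function.update x ⟨a, ha⟩ s) ↔
      Fin.take a ha.le x' = Fin.take a ha.le x ∧ s = x' ⟨a, ha⟩ := by
  simp only [take_eq_take_iff]
  constructor
  · intro h
    refine ⟨fun j hj => ?_, ?_⟩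
    · rw [h j (by omega), Function.update_of_ne]
      rintro rfl
      simp at hj
    · simpa using (h ⟨a, ha⟩ (by simp)).symm
  · rintro ⟨h, rfl⟩ j hj
    by_cases hja : j = ⟨a, ha⟩
    · subst hja
      simp
    · rw [Function.update_of_ne hja]
      refine h j ?_
      have : (j : ℕ) ≠ a := fun h' => hja (Fin.ext h')
      omega

variable (P : (Fin n → 𝒳) → (Fin n → 𝒴) → (Fin n → 𝒵) → ℝ)

theorem prefixProb_eq_sum_left {a b c : ℕ} (ha : a < n) (hb : b ≤ n) (hc : c ≤ n)
    (x : Fin n → 𝒳) (y : Fin n → 𝒴) (z : Fin n → 𝒵) :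
    prefixProb P a b c ha.le hb hc x y z =
      ∑ s, prefixProb P (a + 1) b c ha hb hc (Function.update x ⟨a, ha⟩ s) y z := by
  unfold prefixProb
  conv_rhs => rw [Finset.sum_comm]
  refine Finset.sum_congr rfl fun x' _ => ?_
  conv_rhs => rw [Finset.sum_comm]
  refine Finset.sum_congr rfl fun y' _ => ?_
  conv_rhs => rw [Finset.sum_comm]
  refine Finset.sum_congr rfl fun z' _ => ?_
  simp only [take_succ_eq_take_update_iff, ite_and]
  split_ifs <;> simp

theorem prefixProb_eq_sum_middle {a b c : ℕ} (ha : a ≤ n) (hb : b < n) (hc : c ≤ n)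
    (x : Fin n → 𝒳) (y : Fin n → 𝒴) (z : Fin n → 𝒵) :
    prefixProb P a b c ha hb.le hc x y z =
      ∑ s, prefixProb P a (b + 1) c ha hb hc x (Function.update y ⟨b, hb⟩ s) z := by
  unfold prefixProb
  conv_rhs => rw [Finset.sum_comm]
  refine Finset.sum_congr rfl fun x' _ => ?_
  conv_rhs => rw [Finset.sum_comm]
  refine Finset.sum_congr rfl fun y' _ => ?_
  conv_rhs => rw [Finset.sum_comm]
  refine Finset.sum_congr rfl fun z' _ => ?_
  simp only [take_succ_eq_take_update_iff, ite_and]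
  split_ifs <;> simp

theorem prefixProb_eq_sum_right {a b c : ℕ} (ha : a ≤ n) (hb : b ≤ n) (hc : c < n)
    (x : Fin n → 𝒳) (y : Fin n → 𝒴) (z : Fin n → 𝒵) :
    prefixProb P a b c ha hb hc.le x y z =
      ∑ s, prefixProb P a b (c + 1) ha hb hc x y (Function.update z ⟨c, hc⟩ s) := by
  unfold prefixProb
  conv_rhs => rw [Finset.sum_comm]
  refine Finset.sum_congr rfl fun x' _ => ?_
  conv_rhs => rw [Finset.sum_comm]
  refine Finset.sum_congr rfl fun y' _ => ?_
  conv_rhs => rw [Finset.sum_comm]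
  refine Finset.sum_congr rfl fun z' _ => ?_
  simp only [take_succ_eq_take_update_iff, ite_and]
  split_ifs <;> simp

theorem prefixProb_full (x : Fin n → 𝒳) (y : Fin n → 𝒴) (z : Fin n → 𝒵) :
    prefixProb P n n n le_rfl le_rfl le_rfl x y z = P x y z := by
  simp [prefixProb, ite_and]

theorem prefixProb_zero_full (x : Fin n → 𝒳) (y : Fin n → 𝒴) (z : Fin n → 𝒵) :
    prefixProb P 0 n n n.zero_le le_rfl le_rfl x y z = ∑ x', P x' y z := by
  have h : ∀ x' : Fin n → 𝒳, Fin.take 0 n.zero_le x' = Fin.take 0 n.zero_le x :=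
    fun x' => Subsingleton.elim _ _
  simp [prefixProb, ite_and, h]

theorem prefixProb_zero_zero_zero (x : Fin n → 𝒳) (y : Fin n → 𝒴) (z : Fin n → 𝒵) :
    prefixProb P 0 0 0 n.zero_le n.zero_le n.zero_le x y z = ∑ x', ∑ y', ∑ z', P x' y' z' := by
  unfold prefixProb
  refine Finset.sum_congr rfl fun x' _ => Finset.sum_congr rfl fun y' _ =>
    Finset.sum_congr rfl fun z' _ => ?_
  exact if_pos ⟨Subsingleton.elim _ _, Subsingleton.elim _ _, Subsingleton.elim _ _⟩

theorem prefixProb_nonneg {P : (Fin n → 𝒳) → (Fin n → 𝒴) → (Fin n → 𝒵) → ℝ}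
    (hP : ∀ x y z, 0 ≤ P x y z) {a b c : ℕ} (ha : a ≤ n) (hb : b ≤ n) (hc : c ≤ n)
    (x : Fin n → 𝒳) (y : Fin n → 𝒴) (z : Fin n → 𝒵) :
    0 ≤ prefixProb P a b c ha hb hc x y z :=
  Finset.sum_nonneg fun _ _ => Finset.sum_nonneg fun _ _ => Finset.sum_nonneg fun _ _ => by
    split_ifs
    exacts [hP _ _ _, le_rfl]

/-- Lengthening the middle prefix can only decrease its probability. -/
theorem prefixProb_eq_zero_of_middle {P : (Fin n → 𝒳) → (Fin n → 𝒴) → (Fin n → 𝒵) → ℝ}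
    (hP : ∀ x y z, 0 ≤ P x y z) {a b c : ℕ} (ha : a ≤ n) (hb : b < n) (hc : c ≤ n)
    (x : Fin n → 𝒳) (y : Fin n → 𝒴) (z : Fin n → 𝒵)
    (h : prefixProb P a b c ha hb.le hc x y z = 0) :
    prefixProb P a (b + 1) c ha hb hc x y z = 0 := by
  rw [prefixProb_eq_sum_middle P ha hb hc,
    Finset.sum_eq_zero_iff_of_nonneg fun _ _ => prefixProb_nonneg hP ..] at h
  simpa using h (y ⟨b, hb⟩) (Finset.mem_univ _)

/-- Linear relations between prefix probabilities survive summing out the first sequence. -/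
theorem prefixProb_zero_mul {b c b' c' a : ℕ} (ha : a ≤ n) (hb : b ≤ n) (hc : c ≤ n)
    (hb' : b' ≤ n) (hc' : c' ≤ n) (r : ℝ) (y : Fin n → 𝒴) (z : Fin n → 𝒵)
    (h : ∀ x, prefixProb P a b c ha hb hc x y z * r = prefixProb P a b' c' ha hb' hc' x y z)
    (x : Fin n → 𝒳) :
    prefixProb P 0 b c n.zero_le hb hc x y z * r =
      prefixProb P 0 b' c' n.zero_le hb' hc' x y z := by
  induction a with
  | zero => exact h x
  | succ a ih =>
    refine ih (Nat.le_of_succ_le ha) fun x => ?_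
    rw [prefixProb_eq_sum_left P ha hb hc, prefixProb_eq_sum_left P ha hb' hc', Finset.sum_mul]
    exact Finset.sum_congr rfl fun s _ => h _

end PrefixProb

/-- Telescoping without division, so vanishing terms do no harm. It serves both the output law and
the count of consistent messages. -/
theorem mul_prod_eq_of_mul_eq_succ {n : ℕ} (N : ℕ → ℝ) (g : Fin n → ℝ)
    (h : ∀ i : Fin n, N i * g i = N (i + 1)) : N 0 * ∏ i, g i = N n := by
  induction n with
  | zero => simp
  | succ n ih =>
    rw [Fin.prod_univ_castSucc, ← mul_assoc, ih (fun i => g i.castSucc) fun i => h i.castSucc]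
    exact h (Fin.last n)

theorem sum_pmf_toReal {α : Type*} [Fintype α] (p : PMF α) : ∑ a, (p a).toReal = 1 := by
  rw [← ENNReal.toReal_sum fun a _ => p.apply_ne_top a, ← tsum_fintype (L := .unconditional _),
    p.tsum_coe, ENNReal.toReal_one]

/-! ### Prefix marginals of the joint law and the causal conditional probabilities. -/

namespace Channel

variable {𝒳 𝒴 𝒵 : Type*} {n : ℕ}

/-- The factor of `jointProb` contributed by the input distribution at time `i`. -/
noncomputable def inputFactor (q : InputDist 𝒳 𝒵 n) (i : Fin n) (x : Fin n → 𝒳)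
    (z : Fin n → 𝒵) : ℝ :=
  (q i (Fin.take i i.isLt.le x) (Fin.take i i.isLt.le z) (x i)).toReal

/-- The factor of `transition` contributed by the channel at time `i`. -/
noncomputable def forwardFactor (C : Channel 𝒳 𝒴 𝒵) (i : Fin n) (x : Fin n → 𝒳)
    (y : Fin n → 𝒴) : ℝ :=
  (C.forward i (Fin.take (i + 1) i.isLt x) (Fin.take i i.isLt.le y) (y i)).toReal

/-- The factor of `transition` contributed by the feedback link at time `i`. -/
noncomputable def feedbackFactor (C : Channel 𝒳 𝒴 𝒵) (i : Fin n) (y : Fin n → 𝒴)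
    (z : Fin n → 𝒵) : ℝ :=
  (C.feedback i (Fin.take (i + 1) i.isLt y) (Fin.take i i.isLt.le z) (z i)).toReal

theorem transition_eq (C : Channel 𝒳 𝒴 𝒵) (x : Fin n → 𝒳) (y : Fin n → 𝒴) (z : Fin n → 𝒵) :
    C.transition x y z = (∏ i, C.forwardFactor i x y) * ∏ i, C.feedbackFactor i y z :=
  Finset.prod_mul_distrib

theorem transition_nonneg (C : Channel 𝒳 𝒴 𝒵) (x : Fin n → 𝒳) (y : Fin n → 𝒴)
    (z : Fin n → 𝒵) : 0 ≤ C.transition x y z :=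
  Finset.prod_nonneg fun _ _ => mul_nonneg ENNReal.toReal_nonneg ENNReal.toReal_nonneg

theorem jointProb_nonneg (C : Channel 𝒳 𝒴 𝒵) (q : InputDist 𝒳 𝒵 n) (x : Fin n → 𝒳)
    (y : Fin n → 𝒴) (z : Fin n → 𝒵) : 0 ≤ C.jointProb q x y z :=
  mul_nonneg (Finset.prod_nonneg fun _ _ => ENNReal.toReal_nonneg) (C.transition_nonneg x y z)

/-- The product of the factors of `jointProb` before time `i`. -/
noncomputable def partialProb (C : Channel 𝒳 𝒴 𝒵) (q : InputDist 𝒳 𝒵 n) (i : ℕ)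
    (x : Fin n → 𝒳) (y : Fin n → 𝒴) (z : Fin n → 𝒵) : ℝ :=
  ∏ j : Fin n, if (j : ℕ) < i then
    inputFactor q j x z * C.forwardFactor j x y * C.feedbackFactor j y z else 1

theorem partialProb_zero (C : Channel 𝒳 𝒴 𝒵) (q : InputDist 𝒳 𝒵 n)
    (x : Fin n → 𝒳) (y : Fin n → 𝒴) (z : Fin n → 𝒵) : C.partialProb q 0 x y z = 1 := by
  simp [partialProb]

theorem partialProb_full (C : Channel 𝒳 𝒴 𝒵) (q : InputDist 𝒳 𝒵 n)
    (x : Fin n → 𝒳) (y : Fin n → 𝒴) (z : Fin n → 𝒵) :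
    C.partialProb q n x y z = C.jointProb q x y z := by
  simp only [partialProb, Fin.is_lt, if_true, jointProb, transition_eq, Finset.prod_mul_distrib,
    inputFactor, mul_assoc]

theorem partialProb_succ (C : Channel 𝒳 𝒴 𝒵) (q : InputDist 𝒳 𝒵 n) (i : Fin n)
    (x : Fin n → 𝒳) (y : Fin n → 𝒴) (z : Fin n → 𝒵) :
    C.partialProb q (i + 1) x y z = C.partialProb q i x y z *
      (inputFactor q i x z * C.forwardFactor i x y * C.feedbackFactor i y z) := by
  unfold partialProb
  rw [← Finset.mul_prod_erase _ _ (Finset.mem_univ i),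
    ← Finset.mul_prod_erase (a := i) Finset.univ (fun j : Fin n => if (j : ℕ) < i then _ else _)
      (Finset.mem_univ i)]
  simp only [lt_add_iff_pos_right, zero_lt_one, if_true, lt_irrefl, if_false, one_mul]
  rw [mul_comm]
  congr 1
  refine Finset.prod_congr rfl fun j hj => ?_
  have : (j : ℕ) ≠ i := fun h => Finset.ne_of_mem_erase hj (Fin.ext h)
  exact if_congr (by omega) rfl rfl

theorem partialProb_congr (C : Channel 𝒳 𝒴 𝒵) (q : InputDist 𝒳 𝒵 n) {i : ℕ}
    {x x' : Fin n → 𝒳} {y y' : Fin n → 𝒴} {z z' : Fin n → 𝒵}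
    (hx : ∀ j : Fin n, (j : ℕ) < i → x j = x' j) (hy : ∀ j : Fin n, (j : ℕ) < i → y j = y' j)
    (hz : ∀ j : Fin n, (j : ℕ) < i → z j = z' j) :
    C.partialProb q i x y z = C.partialProb q i x' y' z' := by
  refine Finset.prod_congr rfl fun j _ => ?_
  split_ifs with hj
  · have hx0 := (take_eq_take_iff j.isLt.le x' x).2 fun k hk => hx k (hk.trans hj)
    have hy0 := (take_eq_take_iff j.isLt.le y' y).2 fun k hk => hy k (hk.trans hj)
    have hz0 := (take_eq_take_iff j.isLt.le z' z).2 fun k hk => hz k (hk.trans hj)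
    have hx1 := (take_eq_take_iff (Nat.succ_le_of_lt j.isLt) x' x).2 fun k hk => hx k (by omega)
    have hy1 := (take_eq_take_iff (Nat.succ_le_of_lt j.isLt) y' y).2 fun k hk => hy k (by omega)
    unfold inputFactor forwardFactor feedbackFactor
    rw [hx0, hy0, hz0, hx1, hy1, hx j hj, hy j hj, hz j hj]
  · rfl

theorem update_apply_of_lt {α : Type*} (u : Fin n → α) (i : Fin n) (s : α) (j : Fin n)
    (hj : (j : ℕ) < i) : Function.update u i s j = u j :=
  Function.update_of_ne (by rintro rfl; omega) _ _

theorem sum_inputFactor_update [Fintype 𝒳] (q : InputDist 𝒳 𝒵 n) (i : Fin n) (x : Fin n → 𝒳)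
    (z : Fin n → 𝒵) : ∑ s, inputFactor q i (Function.update x i s) z = 1 := by
  simp only [inputFactor, take_update_of_le _ _ _ le_rfl, Function.update_self]
  exact sum_pmf_toReal _

theorem sum_forwardFactor_update [Fintype 𝒴] (C : Channel 𝒳 𝒴 𝒵) (i : Fin n) (x : Fin n → 𝒳)
    (y : Fin n → 𝒴) : ∑ s, C.forwardFactor i x (Function.update y i s) = 1 := by
  simp only [forwardFactor, take_update_of_le _ _ _ le_rfl, Function.update_self]
  exact sum_pmf_toReal _

theorem sum_feedbackFactor_update [Fintype 𝒵] (C : Channel 𝒳 𝒴 𝒵) (i : Fin n) (y : Fin n → 𝒴)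
    (z : Fin n → 𝒵) : ∑ s, C.feedbackFactor i y (Function.update z i s) = 1 := by
  simp only [feedbackFactor, take_update_of_le _ _ _ le_rfl, Function.update_self]
  exact sum_pmf_toReal _

theorem inputFactor_update_right (q : InputDist 𝒳 𝒵 n) (i : Fin n) (x : Fin n → 𝒳)
    (z : Fin n → 𝒵) (s : 𝒵) :
    inputFactor q i x (Function.update z i s) = inputFactor q i x z := by
  simp only [inputFactor, take_update_of_le _ _ _ le_rfl]


/-- Its contrapositive keeps the denominators in `causalProbXZ` nonzero on the support of the joint
law. -/
theorem jointProb_eq_zero_of_factor (C : Channel 𝒳 𝒴 𝒵) (q : InputDist 𝒳 𝒵 n) (i : Fin n)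
    (x : Fin n → 𝒳) (y : Fin n → 𝒴) (z : Fin n → 𝒵)
    (h : C.partialProb q i x y z * inputFactor q i x z = 0) : C.jointProb q x y z = 0 := by
  rw [← partialProb_full, partialProb, Finset.prod_eq_zero_iff]
  rcases mul_eq_zero.1 h with h | h
  · obtain ⟨j, hj, h⟩ := Finset.prod_eq_zero_iff.1 h
    refine ⟨j, hj, ?_⟩
    split_ifs at h with hji
    · simpa using h
    · simp at h
  · exact ⟨i, Finset.mem_univ _, by simp [h]⟩

variable [Fintype 𝒳] [Fintype 𝒴] [Fintype 𝒵] [DecidableEq 𝒳] [DecidableEq 𝒴] [DecidableEq 𝒵]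

/-- First of three links of a descending induction: summing out `z_i`, then `y_i`, then `x_i`
removes one kernel of total mass one each time. Each link takes the previous one as hypothesis;
`prefixProb_diag` closes the loop. -/
theorem prefixProb_forward_of (C : Channel 𝒳 𝒴 𝒵) (q : InputDist 𝒳 𝒵 n) (i : Fin n)
    (h : ∀ x y z, prefixProb (C.jointProb q) (i + 1) (i + 1) (i + 1) i.isLt i.isLt i.isLt x y z =
      C.partialProb q (i + 1) x y z) (x : Fin n → 𝒳) (y : Fin n → 𝒴) (z : Fin n → 𝒵) :
    prefixProb (C.jointProb q) (i + 1) (i + 1) i i.isLt i.isLt i.isLt.le x y z =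
      C.partialProb q i x y z * (inputFactor q i x z * C.forwardFactor i x y) := by
  rw [prefixProb_eq_sum_right _ i.isLt i.isLt i.isLt]
  have h' (s : 𝒵) : prefixProb (C.jointProb q) (i + 1) (i + 1) (i + 1) i.isLt i.isLt i.isLt x y
      (Function.update z i s) = C.partialProb q i x y z *
        (inputFactor q i x z * C.forwardFactor i x y) *
          C.feedbackFactor i y (Function.update z i s) := by
    rw [h, partialProb_succ, inputFactor_update_right, ← mul_assoc]
    congr 2
    exact partialProb_congr C q (fun _ _ => rfl) (fun _ _ => rfl) (update_apply_of_lt z i s)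
  simp only [Fin.eta, h', ← Finset.mul_sum, sum_feedbackFactor_update, mul_one]

theorem prefixProb_input_of (C : Channel 𝒳 𝒴 𝒵) (q : InputDist 𝒳 𝒵 n) (i : Fin n)
    (h : ∀ x y z, prefixProb (C.jointProb q) (i + 1) (i + 1) i i.isLt i.isLt i.isLt.le x y z =
      C.partialProb q i x y z * (inputFactor q i x z * C.forwardFactor i x y))
    (x : Fin n → 𝒳) (y : Fin n → 𝒴) (z : Fin n → 𝒵) :
    prefixProb (C.jointProb q) (i + 1) i i i.isLt i.isLt.le i.isLt.le x y z =
      C.partialProb q i x y z * inputFactor q i x z := by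
  rw [prefixProb_eq_sum_middle _ i.isLt i.isLt i.isLt.le]
  have h' (s : 𝒴) : prefixProb (C.jointProb q) (i + 1) (i + 1) i i.isLt i.isLt i.isLt.le x
      (Function.update y i s) z = C.partialProb q i x y z * inputFactor q i x z *
          C.forwardFactor i x (Function.update y i s) := by
    rw [h, ← mul_assoc]
    congr 2
    exact partialProb_congr C q (fun _ _ => rfl) (update_apply_of_lt y i s) (fun _ _ => rfl)
  simp only [Fin.eta, h', ← Finset.mul_sum, sum_forwardFactor_update, mul_one]

theorem prefixProb_diag_of (C : Channel 𝒳 𝒴 𝒵) (q : InputDist 𝒳 𝒵 n) (i : Fin n)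
    (h : ∀ x y z, prefixProb (C.jointProb q) (i + 1) i i i.isLt i.isLt.le i.isLt.le x y z =
      C.partialProb q i x y z * inputFactor q i x z)
    (x : Fin n → 𝒳) (y : Fin n → 𝒴) (z : Fin n → 𝒵) :
    prefixProb (C.jointProb q) i i i i.isLt.le i.isLt.le i.isLt.le x y z =
      C.partialProb q i x y z := by
  rw [prefixProb_eq_sum_left _ i.isLt i.isLt.le i.isLt.le]
  have h' (s : 𝒳) : prefixProb (C.jointProb q) (i + 1) i i i.isLt i.isLt.le i.isLt.le
      (Function.update x i s) y z = C.partialProb q i x y z *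
        inputFactor q i (Function.update x i s) z := by
    rw [h]
    congr 1
    exact partialProb_congr C q (update_apply_of_lt x i s) (fun _ _ => rfl) (fun _ _ => rfl)
  simp only [Fin.eta, h', ← Finset.mul_sum, sum_inputFactor_update, mul_one]

theorem prefixProb_diag (C : Channel 𝒳 𝒴 𝒵) (q : InputDist 𝒳 𝒵 n) (i : ℕ) (hi : i ≤ n) :
    ∀ x y z, prefixProb (C.jointProb q) i i i hi hi hi x y z = C.partialProb q i x y z := by
  induction hi using Nat.decreasingInduction with
  | self => exact fun x y z => (prefixProb_full _ x y z).trans (partialProb_full C q x y z).symm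
  | of_succ k hk ih =>
    exact prefixProb_diag_of C q ⟨k, hk⟩ (prefixProb_input_of C q ⟨k, hk⟩
      (prefixProb_forward_of C q ⟨k, hk⟩ ih))

theorem prefixProb_forward (C : Channel 𝒳 𝒴 𝒵) (q : InputDist 𝒳 𝒵 n) (i : Fin n)
    (x : Fin n → 𝒳) (y : Fin n → 𝒴) (z : Fin n → 𝒵) :
    prefixProb (C.jointProb q) (i + 1) (i + 1) i i.isLt i.isLt i.isLt.le x y z =
      C.partialProb q i x y z * (inputFactor q i x z * C.forwardFactor i x y) :=
  prefixProb_forward_of C q i (prefixProb_diag C q (i + 1) i.isLt) x y z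

theorem prefixProb_input (C : Channel 𝒳 𝒴 𝒵) (q : InputDist 𝒳 𝒵 n) (i : Fin n)
    (x : Fin n → 𝒳) (y : Fin n → 𝒴) (z : Fin n → 𝒵) :
    prefixProb (C.jointProb q) (i + 1) i i i.isLt i.isLt.le i.isLt.le x y z =
      C.partialProb q i x y z * inputFactor q i x z :=
  prefixProb_input_of C q i (prefixProb_forward C q i) x y z

/-- Given the inputs and past outputs, the past feedback carries no further information on the next
output. -/
theorem causalProbXZ_jointProb (C : Channel 𝒳 𝒴 𝒵) (q : InputDist 𝒳 𝒵 n)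
    (x : Fin n → 𝒳) (y : Fin n → 𝒴) (z : Fin n → 𝒵) (h : C.jointProb q x y z ≠ 0) :
    causalProbXZ (C.jointProb q) x y z = ∏ i, C.forwardFactor i x y := by
  refine Finset.prod_congr rfl fun i _ => ?_
  have h0 := mt (jointProb_eq_zero_of_factor C q i x y z) h
  rw [prefixProb_forward, prefixProb_input, ← mul_assoc, mul_div_cancel_left₀ _ h0]

theorem sum_jointProb [Nonempty (Fin n → 𝒳)] [Nonempty (Fin n → 𝒴)] [Nonempty (Fin n → 𝒵)]
    (C : Channel 𝒳 𝒴 𝒵) (q : InputDist 𝒳 𝒵 n) :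
    ∑ x, ∑ y, ∑ z, C.jointProb q x y z = 1 := by
  obtain ⟨x⟩ := ‹Nonempty (Fin n → 𝒳)›
  obtain ⟨y⟩ := ‹Nonempty (Fin n → 𝒴)›
  obtain ⟨z⟩ := ‹Nonempty (Fin n → 𝒵)›
  rw [← prefixProb_zero_zero_zero _ x y z, prefixProb_diag, partialProb_zero]

/-- The joint law of the outputs is the causal conditional probability of the channel outputs times
that of the outputs of the feedback link. -/
theorem causalProbZ_jointProb_mul (C : Channel 𝒳 𝒴 𝒵) (q : InputDist 𝒳 𝒵 n)
    (x : Fin n → 𝒳) (y : Fin n → 𝒴) (z : Fin n → 𝒵) :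
    causalProbZ (C.jointProb q) x y z * ∏ i, C.feedbackFactor i y z =
      ∑ x', C.jointProb q x' y z := by
  -- `N i` is `p(y^i, z^i)`; the value beyond `n` is never used.
  let N : ℕ → ℝ := fun i =>
    if h : i ≤ n then prefixProb (C.jointProb q) 0 i i n.zero_le h h x y z else 0
  have key := mul_prod_eq_of_mul_eq_succ N (fun i : Fin n =>
    prefixProb (C.jointProb q) 0 (i + 1) i n.zero_le i.isLt i.isLt.le x y z /
      prefixProb (C.jointProb q) 0 i i n.zero_le i.isLt.le i.isLt.le x y z *
        C.feedbackFactor i y z) ?_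
  · have h0 : N 0 = 1 := by
      simp only [N, dif_pos n.zero_le]
      rw [prefixProb_diag, partialProb_zero]
    have hn : N n = ∑ x', C.jointProb q x' y z := by
      simp only [N, dif_pos le_rfl]
      exact prefixProb_zero_full _ x y z
    rw [h0, one_mul, hn, Finset.prod_mul_distrib] at key
    exact key
  · intro i
    simp only [N, dif_pos i.isLt.le, dif_pos (Nat.succ_le_of_lt i.isLt)]
    -- Where the denominator vanishes, so does the numerator.
    rw [← mul_assoc, mul_div_cancel_of_imp' (prefixProb_eq_zero_of_middle
      (C.jointProb_nonneg q) n.zero_le i.isLt i.isLt.le x y z)]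
    -- The feedback factor does not involve `x`, so the relation for full prefixes can be summed
    -- over the inputs.
    refine prefixProb_zero_mul (a := i + 1) _ i.isLt _ _ _ _ _ _ _ (fun x => ?_) x
    rw [prefixProb_forward, prefixProb_diag, partialProb_succ, mul_assoc]

end Channel

/-! ### The input distribution induced by a code. -/

theorem card_mul_map_uniformOfFinset_toReal {α β : Type*} [Fintype α] [DecidableEq β]
    (s : Finset α) (hs : s.Nonempty) (f : α → β) (b : β) :
    (s.card : ℝ) * ((PMF.uniformOfFinset s hs).map f b).toReal =
      ((s.filter fun a => f a = b).card : ℝ) := by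
  classical
  have h : (PMF.uniformOfFinset s hs).map f b =
      ((s.filter fun a => f a = b).card : ENNReal) * (s.card : ENNReal)⁻¹ := by
    rw [PMF.map_apply, tsum_fintype, ← nsmul_eq_mul, ← Finset.sum_const, Finset.sum_filter,
      ← Finset.sum_subset (Finset.subset_univ s)]
    · refine Finset.sum_congr rfl fun a ha => ?_
      simp [PMF.uniformOfFinset_apply, ha, eq_comm]
    · intro a _ ha
      simp [PMF.uniformOfFinset_apply, ha]
  have h0 : (s.card : ℝ) ≠ 0 := by exact_mod_cast hs.card_pos.ne'
  rw [h, ENNReal.toReal_mul, ENNReal.toReal_inv, ENNReal.toReal_natCast, ENNReal.toReal_natCast]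
  field_simp

theorem sum_rotate {α β γ : Type*} [Fintype α] [Fintype β] [Fintype γ] (f : α → β → γ → ℝ) :
    ∑ a, ∑ b, ∑ c, f a b c = ∑ b, ∑ c, ∑ a, f a b c := by
  rw [Finset.sum_comm]
  exact Finset.sum_congr rfl fun b _ => Finset.sum_comm

namespace Code

variable {𝒳 𝒴 𝒵 : Type*} [DecidableEq 𝒳] {n M : ℕ}

/-- The messages for which the code produces the inputs `x` when the feedback is `z`. -/
def consistent (c : Code 𝒳 𝒴 𝒵 n M) (i : Fin n) (x : Fin i → 𝒳) (z : Fin i → 𝒵) :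
    Finset (Fin M) :=
  Finset.univ.filter fun w =>
    ∀ j : Fin i, c.encode w (Fin.castLE i.isLt.le j) (Fin.take j j.isLt.le z) = x j

/-- The channel input distribution induced by a code with uniformly distributed messages: the
conditional law of the input given the past inputs and the past feedback. -/
noncomputable def inputDist (c : Code 𝒳 𝒴 𝒵 n M) (w₀ : Fin M) : InputDist 𝒳 𝒵 n :=
  fun i x z =>
    if h : (c.consistent i x z).Nonempty then
      (PMF.uniformOfFinset _ h).map fun w => c.encode w i z
    -- No message produces such a history, so the value is immaterial.
    else PMF.pure (c.encode w₀ i z)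

theorem consistent_take (c : Code 𝒳 𝒴 𝒵 n M) (i : Fin n) (x : Fin n → 𝒳) (z : Fin n → 𝒵) :
    c.consistent i (Fin.take i i.isLt.le x) (Fin.take i i.isLt.le z) =
      Finset.univ.filter fun w => ∀ j : Fin n, (j : ℕ) < i → c.input w z j = x j := by
  ext w
  simp only [consistent, Finset.mem_filter, Finset.mem_univ, true_and]
  exact ⟨fun h j hj => h ⟨j, hj⟩, fun h j => h (Fin.castLE i.isLt.le j) j.isLt⟩

/-- Each factor is the fraction of the messages consistent so far that remain consistent after one
more letter, so the product telescopes from `M`. -/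
theorem card_mul_prod_inputFactor [DecidableEq 𝒵] (c : Code 𝒳 𝒴 𝒵 n M) (w₀ : Fin M)
    (x : Fin n → 𝒳) (z : Fin n → 𝒵) :
    (M : ℝ) * ∏ i, Channel.inputFactor (c.inputDist w₀) i x z =
      ((Finset.univ.filter fun w => c.input w z = x).card : ℝ) := by
  have key := mul_prod_eq_of_mul_eq_succ
    (fun k => ((Finset.univ.filter fun w : Fin M =>
      ∀ j : Fin n, (j : ℕ) < k → c.input w z j = x j).card : ℝ))
    (fun i => Channel.inputFactor (c.inputDist w₀) i x z) ?_
  · simpa [funext_iff] using key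
  · intro i
    have hs : ((c.consistent i (Fin.take i i.isLt.le x) (Fin.take i i.isLt.le z)).filter
        fun w => c.encode w i (Fin.take i i.isLt.le z) = x i) =
        Finset.univ.filter fun w : Fin M =>
          ∀ j : Fin n, (j : ℕ) < i + 1 → c.input w z j = x j := by
      rw [consistent_take]
      ext w
      simp only [Finset.mem_filter, Finset.mem_univ, true_and]
      constructor
      · rintro ⟨h, hi⟩ j hj
        rcases Nat.lt_succ_iff_lt_or_eq.1 hj with hj | hj
        · exact h j hj
        · obtain rfl := Fin.ext hj
          exact hi
      · exact fun h => ⟨fun j hj => h j (by omega), h i (by omega)⟩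
    simp only [← hs, ← consistent_take, Channel.inputFactor, inputDist]
    split_ifs with h
    · exact card_mul_map_uniformOfFinset_toReal _ h _ _
    · rw [Finset.not_nonempty_iff_eq_empty.1 h]
      simp

end Code

/-- This is `log u ≤ u - 1` at `u = d * m / t`: a pointwise Gibbs inequality with `m` as a guess for
the likelihood ratio `t / d`. The correction is linear in `t` and `d * m`, hence easy to sum. -/
theorem mul_logb_add_le {t d m : ℝ} (ht : 0 ≤ t) (hd : 0 ≤ d) (htd : t ≠ 0 → d ≠ 0)
    (hm : 0 < m) :
    t * Real.logb 2 m + (t - d * m) / Real.log 2 ≤ t * Real.logb 2 (t / d) := by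
  have h2 : 0 < Real.log 2 := Real.log_pos one_lt_two
  rcases ht.eq_or_lt with rfl | ht
  · simp only [zero_mul, zero_add, zero_sub]
    exact div_nonpos_of_nonpos_of_nonneg (neg_nonpos.2 (mul_nonneg hd hm.le)) h2.le
  · have hd : 0 < d := hd.lt_of_ne (htd ht.ne').symm
    have h := Real.log_le_sub_one_of_pos (div_pos (mul_pos hd hm) ht)
    rw [Real.log_div (mul_pos hd hm).ne' ht.ne', Real.log_mul hd.ne' hm.ne'] at h
    have h' := mul_le_mul_of_nonneg_left h ht.le
    rw [mul_sub t (d * m / t), mul_div_cancel₀ _ ht.ne'] at h'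
    simp only [Real.logb, Real.log_div ht.ne' hd.ne']
    rw [mul_div_assoc', mul_div_assoc', ← add_div]
    gcongr
    linarith

/-! ### The law of a code and Fano's inequality. -/

namespace Channel

variable {𝒳 𝒴 𝒵 : Type*} {n M : ℕ}

theorem jointProb_inputDist [DecidableEq 𝒳] [DecidableEq 𝒵] (C : Channel 𝒳 𝒴 𝒵)
    (c : Code 𝒳 𝒴 𝒵 n M) (w₀ : Fin M)
    (x : Fin n → 𝒳) (y : Fin n → 𝒴) (z : Fin n → 𝒵) :
    C.jointProb (c.inputDist w₀) x y z =
      1 / (M : ℝ) * ∑ w, if c.input w z = x then C.transition x y z else 0 := by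
  have hM : (M : ℝ) ≠ 0 := by exact_mod_cast (Fin.pos w₀).ne'
  rw [← Finset.sum_filter, Finset.sum_const, nsmul_eq_mul, ← c.card_mul_prod_inputFactor w₀,
    jointProb]
  simp only [inputFactor]
  field_simp

variable [Fintype 𝒳] [Fintype 𝒴] [Fintype 𝒵] [DecidableEq 𝒳] [DecidableEq 𝒵]

theorem sum_jointProb_inputDist_mul (C : Channel 𝒳 𝒴 𝒵) (c : Code 𝒳 𝒴 𝒵 n M) (w₀ : Fin M)
    (L : (Fin n → 𝒳) → (Fin n → 𝒴) → (Fin n → 𝒵) → ℝ) :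
    ∑ x, ∑ y, ∑ z, C.jointProb (c.inputDist w₀) x y z * L x y z =
      1 / (M : ℝ) * ∑ w, ∑ y, ∑ z,
        C.transition (c.input w z) y z * L (c.input w z) y z := by
  simp only [jointProb_inputDist, mul_assoc, ← Finset.mul_sum, Finset.sum_mul, ite_mul, zero_mul]
  congr 1
  rw [sum_rotate, sum_rotate fun w y z => C.transition (c.input w z) y z * L (c.input w z) y z]
  refine Finset.sum_congr rfl fun y _ => Finset.sum_congr rfl fun z _ => ?_
  rw [Finset.sum_comm]
  simp

variable [DecidableEq 𝒴]

/-- Multiplying both causal probabilities by the feedback product turns them into the transition and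
the output law. -/
theorem causalDirectedInfo_jointProb (C : Channel 𝒳 𝒴 𝒵) (q : InputDist 𝒳 𝒵 n) :
    causalDirectedInfo (C.jointProb q) = ∑ x, ∑ y, ∑ z, C.jointProb q x y z *
      Real.logb 2 (C.transition x y z / ∑ x', C.jointProb q x' y z) := by
  refine Finset.sum_congr rfl fun x _ => Finset.sum_congr rfl fun y _ =>
    Finset.sum_congr rfl fun z _ => ?_
  by_cases h : C.jointProb q x y z = 0
  · simp [h]
  · have hT : C.transition x y z ≠ 0 := fun h0 => h (by rw [jointProb, h0, mul_zero])
    rw [transition_eq] at hT ⊢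
    rw [causalProbXZ_jointProb C q x y z h, ← causalProbZ_jointProb_mul C q x y z,
      mul_div_mul_right _ _ (right_ne_zero_of_mul hT)]

/-- Fano's inequality in terms of the causal conditional directed information. -/
theorem le_causalDirectedInfo [Nonempty 𝒳] [Nonempty 𝒴] [Nonempty 𝒵] (C : Channel 𝒳 𝒴 𝒵)
    (c : Code 𝒳 𝒴 𝒵 n M) (w₀ : Fin M) :
    (1 - C.avgErrorProb c) * Real.logb 2 M - 1 ≤
      causalDirectedInfo (C.jointProb (c.inputDist w₀)) := by
  have hM1 : (1 : ℝ) ≤ M := by exact_mod_cast Fin.pos w₀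
  have hM : (M : ℝ) ≠ 0 := by positivity
  set q := c.inputDist w₀ with hq
  set D : (Fin n → 𝒴) → (Fin n → 𝒵) → ℝ := fun y z => ∑ x', C.jointProb q x' y z
  have hD0 (y z) : 0 ≤ D y z := Finset.sum_nonneg fun x _ => C.jointProb_nonneg q x y z
  -- The guessed likelihood ratio mixes the decoder's choice and the uniform law in equal parts, so
  -- that `D * m / M` has total mass one while `m` stays positive. The weight `1/2` costs one bit.
  let m : (Fin n → 𝒴) → Fin M → ℝ := fun y w => (if c.decode y = w then (M : ℝ) / 2 else 0) + 1 / 2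
  have hTsum : 1 / (M : ℝ) * ∑ w, ∑ y, ∑ z, C.transition (c.input w z) y z = 1 := by
    have h := C.sum_jointProb_inputDist_mul c w₀ fun _ _ _ => 1
    simp only [mul_one] at h
    rw [← h, sum_jointProb]
  have hDsum : ∑ y, ∑ z, D y z = 1 := by
    exact (sum_rotate fun x y z => C.jointProb q x y z).symm.trans (C.sum_jointProb q)
  have hDm : 1 / (M : ℝ) * ∑ w, ∑ y, ∑ z, D y z * m y w = 1 := by
    have hm (y) : ∑ w, m y w = M := by
      simp only [m, Finset.sum_add_distrib, Finset.sum_ite_eq, Finset.mem_univ, if_true,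
        Finset.sum_const, Finset.card_univ, Fintype.card_fin, nsmul_eq_mul]
      ring
    have : ∑ w, ∑ y, ∑ z, D y z * m y w = M := by
      simp only [← Finset.sum_mul]
      rw [Finset.sum_comm]
      simp only [← Finset.mul_sum, hm]
      rw [← Finset.sum_mul, hDsum, one_mul]
    rw [this, one_div_mul_cancel hM]
  have hcorrect : 1 / (M : ℝ) * ∑ w, ∑ y, ∑ z,
      (if c.decode y = w then C.transition (c.input w z) y z else 0) = 1 - C.avgErrorProb c := by
    rw [eq_sub_iff_add_eq, avgErrorProb, ← mul_add, ← Finset.sum_add_distrib]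
    simp only [errorProb, ← Finset.sum_add_distrib]
    refine Eq.trans ?_ hTsum
    congr 1
    refine Finset.sum_congr rfl fun w _ => Finset.sum_congr rfl fun y _ =>
      Finset.sum_congr rfl fun z _ => ?_
    by_cases h : c.decode y = w <;> simp [h]
  have hpt (w : Fin M) (y : Fin n → 𝒴) (z : Fin n → 𝒵) :
      (if c.decode y = w then C.transition (c.input w z) y z else 0) * Real.logb 2 M -
          C.transition (c.input w z) y z +
        (C.transition (c.input w z) y z - D y z * m y w) / Real.log 2 ≤
      C.transition (c.input w z) y z *
        Real.logb 2 (C.transition (c.input w z) y z / D y z) := by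
    have hT := C.transition_nonneg (c.input w z) y z
    have hm : 0 < m y w := by
      simp only [m]
      split_ifs <;> positivity
    refine le_trans ?_ (mul_logb_add_le hT (hD0 y z) (fun hT0 hDz => hT0 ?_) hm)
    · have hlog : (if c.decode y = w then Real.logb 2 M else 0) - 1 ≤ Real.logb 2 (m y w) := by
        have h2 : Real.logb 2 (2 : ℝ) = 1 := Real.logb_self_eq_one one_lt_two
        simp only [m]
        split_ifs
        · rw [← h2, ← Real.logb_div hM two_ne_zero]
          exact Real.logb_le_logb_of_le one_lt_two (by positivity) (by linarith)
        · rw [zero_add, one_div, Real.logb_inv, h2, zero_sub]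
      have h' := mul_le_mul_of_nonneg_left hlog hT
      rw [mul_sub, mul_one, mul_ite, mul_zero] at h'
      rw [ite_mul, zero_mul]
      linarith
    -- If the output law vanishes at `(y, z)`, so does the contribution of each single message.
    · have h0 := (Finset.sum_eq_zero_iff_of_nonneg
        fun x _ => C.jointProb_nonneg q x y z).1 hDz (c.input w z) (Finset.mem_univ _)
      rw [hq, jointProb_inputDist, mul_eq_zero, Finset.sum_eq_zero_iff_of_nonneg] at h0
      · simpa using (h0.resolve_left (one_div_ne_zero hM)) w (Finset.mem_univ _)
      · intro w' _
        split_ifs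
        exacts [C.transition_nonneg _ _ _, le_rfl]
  have hsum := mul_le_mul_of_nonneg_left (Finset.sum_le_sum fun w (_ : w ∈ Finset.univ) =>
    Finset.sum_le_sum fun y (_ : y ∈ Finset.univ) =>
      Finset.sum_le_sum fun z (_ : z ∈ Finset.univ) => hpt w y z)
    (one_div_nonneg.2 (Nat.cast_nonneg (α := ℝ) M))
  rw [← C.sum_jointProb_inputDist_mul c w₀ fun x y z => Real.logb 2 (C.transition x y z / D y z),
    ← causalDirectedInfo_jointProb] at hsum
  refine le_trans (le_of_eq ?_) hsum
  simp only [Finset.sum_add_distrib, Finset.sum_sub_distrib, ← Finset.sum_mul, ← Finset.sum_div,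
    mul_add, mul_sub, ← mul_assoc, ← mul_div_assoc, hcorrect, hTsum]
  simp only [Finset.sum_mul, hDm]
  ring

end Channel

end NoisyFeedback

/-! ### Passage to the limit. -/

theorem theorem6 {𝒳 𝒴 𝒵 : Type*} [Fintype 𝒳] [Fintype 𝒴] [Fintype 𝒵]
    [DecidableEq 𝒳] [DecidableEq 𝒴] [DecidableEq 𝒵]
    (C : NoisyFeedback.Channel 𝒳 𝒴 𝒵) :
    C.capacity ≤
      ⨆ X : NoisyFeedback.InputProcess 𝒳 𝒵,
        Filter.liminf
          (fun n : ℕ =>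
            (((1 / (n : ℝ)) * NoisyFeedback.causalDirectedInfo (C.jointProb (X n)) : ℝ) : EReal))
          Filter.atTop := by
  refine sSup_le ?_
  rintro _ ⟨R, hR, rfl⟩
  refine le_of_forall_lt_imp_le_of_dense fun a ha => ?_
  obtain ⟨r, har, hrR⟩ := EReal.lt_iff_exists_real_btwn.1 ha
  refine har.le.trans ?_
  have hη : 0 < R - r := sub_pos.2 (EReal.coe_lt_coe_iff.1 hrR)
  set η := R - r with hη_def
  have hR0 : 0 ≤ R := (hR (1 / 2) (by norm_num) (by norm_num)).1
  have hden : 0 < 3 * (R + 1) + η := by positivity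
  -- The gap `η` is split in three: the rate slack `δ`, the loss `ε * R`, and the bit lost in Fano's
  -- inequality divided by `n`.
  set ε := η / (3 * (R + 1) + η) with hε
  have hε0 : 0 < ε := div_pos hη hden
  have hε1 : ε < 1 := (div_lt_one hden).2 (by linarith)
  have hεR : ε * R ≤ η / 3 := by
    rw [hε, div_mul_eq_mul_div, div_le_iff₀ hden]
    nlinarith
  have hev : ∀ᶠ n : ℕ in Filter.atTop, ∃ q : NoisyFeedback.InputDist 𝒳 𝒵 n,
      r ≤ 1 / (n : ℝ) * NoisyFeedback.causalDirectedInfo (C.jointProb q) := by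
    filter_upwards [(hR ε hε0 hε1).2 (η / 3) (by positivity), Filter.eventually_ge_atTop 1,
      Filter.eventually_ge_atTop ⌈3 / η⌉₊] with n hn hn1 hnη
    obtain ⟨M, hM, c, hc, hrate⟩ := hn
    let w₀ : Fin M := ⟨0, hM⟩
    have : Nonempty 𝒳 := ⟨c.encode w₀ ⟨0, hn1⟩ Fin.elim0⟩
    have : Nonempty 𝒴 :=
      (C.forward 0 (fun _ => Classical.arbitrary 𝒳) Fin.elim0).support_nonempty.to_type
    have : Nonempty 𝒵 :=
      (C.feedback 0 (fun _ => Classical.arbitrary 𝒴) Fin.elim0).support_nonempty.to_type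
    refine ⟨c.inputDist w₀, ?_⟩
    have hn0 : (0 : ℝ) < n := by exact_mod_cast hn1
    have hinv : 1 / (n : ℝ) ≤ η / 3 := by
      rw [div_le_iff₀ hn0]
      have := (div_le_iff₀ hη).1 (Nat.ceil_le.1 hnη)
      linarith
    have hl : 0 ≤ Real.logb 2 M / n :=
      div_nonneg (Real.logb_nonneg one_lt_two (by exact_mod_cast hM)) hn0.le
    have h := mul_le_mul_of_nonneg_left (C.le_causalDirectedInfo c w₀)
      (one_div_nonneg.2 hn0.le)
    have h1 : 1 / (n : ℝ) * ((1 - C.avgErrorProb c) * Real.logb 2 M - 1) =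
        (1 - C.avgErrorProb c) * (Real.logb 2 M / n) - 1 / n := by ring
    rw [h1] at h
    have h2 : (1 - ε) * (R - η / 3) ≤ (1 - C.avgErrorProb c) * (Real.logb 2 M / n) :=
      (mul_le_mul_of_nonneg_left hrate (by linarith)).trans
        (mul_le_mul_of_nonneg_right (by linarith) hl)
    nlinarith [mul_pos hε0 hη]
  have hne : Nonempty 𝒳 := by
    obtain ⟨n, hn, h⟩ :=
      (((hR ε hε0 hε1).2 1 one_pos).and (Filter.eventually_ge_atTop 1)).exists
    obtain ⟨M, hM, c, -⟩ := hn
    exact ⟨c.encode ⟨0, hM⟩ ⟨0, h⟩ Fin.elim0⟩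
  -- A process needs an input distribution at every horizon, including the finitely many where `r`
  -- may not be reached; there an arbitrary one is used.
  have hX (n : ℕ) : ∃ q : NoisyFeedback.InputDist 𝒳 𝒵 n,
      (∃ q' : NoisyFeedback.InputDist 𝒳 𝒵 n,
        r ≤ 1 / (n : ℝ) * NoisyFeedback.causalDirectedInfo (C.jointProb q')) →
      r ≤ 1 / (n : ℝ) * NoisyFeedback.causalDirectedInfo (C.jointProb q) := by
    by_cases h : ∃ q' : NoisyFeedback.InputDist 𝒳 𝒵 n,
        r ≤ 1 / (n : ℝ) * NoisyFeedback.causalDirectedInfo (C.jointProb q')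
    · exact h.imp fun q hq _ => hq
    · exact ⟨fun _ _ _ => PMF.pure hne.some, fun h' => absurd h' h⟩
  choose X hX using hX
  refine le_iSup_of_le X (Filter.le_liminf_of_le (by isBoundedDefault) ?_)
  exact hev.mono fun n hn => EReal.coe_le_coe_iff.2 (hX n hn)
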